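/- Consider one macrocell base station (MBS, index $0$) and femtocell users $k\in\mathcal K=\{1,\dots,K\}$, with channel power gains $h_{i,j}\ge 0$ ($i,j\in\mathcal K\cup\{0\}$), $h_{k,0}>0$ for $k\in\mathcal K$, noise variances $N_i>0$, macrocell user power $p_0\ge 0$, bandwidth $W>0$ and circuit power $p_a>0$. Let user $k$ choose its power from a finite set $\mathcal P_k\subset[0,\infty)$ with $0\in\mathcal P_k$. For $\mathbf p\in\mathcal P=\prod_k\mathcal P_k$ let $$\gamma_k(\mathbf p)=\frac{h_{k,k}p_k}{N_k+h_{0,k}p_0+\sum_{j\in\mathcal K\setminus\{k\}}h_{j,k}p_j},\qquad \psi_k(\mathbf p)=\frac{W\log(1+\gamma_k(\mathbf p))}{p_k+p_a}.$$ The MBS chooses a price vector $\boldsymbol\lambda\in\Lambda=[0,\infty)^K$, and user $k$ chooses a mixed strategy, i.e. a probability vector $\pi_k$ on $\mathcal P_k$. For $\boldsymbol\pi=(\pi_1,\dots,\pi_K)$ the expected payoffs are $$u_k(\boldsymbol\pi,\boldsymbol\lambda)=\sum_{\mathbf p\in\mathcal P}\bigl(\psi_k(\mathbf p)-\lambda_kh_{k,0}p_k\bigr)\prod_{i\in\mathcal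 K}\pi_i(p_i),\qquad u_0(\boldsymbol\lambda,\boldsymbol\pi)=\sum_{k\in\mathcal K}\lambda_k\sum_{p\in\mathcal P_k}\pi_k(p)h_{k,0}p .$$ Call $\boldsymbol\pi$ a follower equilibrium at $\boldsymbol\lambda$ if $u_k(\boldsymbol\pi,\boldsymbol\lambda)\ge u_k((\pi_k',\boldsymbol\pi_{-k}),\boldsymbol\lambda)$ for every $k$ and every probability vector $\pi'_k$ on $\mathcal P_k$. Then this Stackelberg game has an equilibrium consisting of a mixed-strategy power allocation and a pure-strategy price vector that is finite in each component, in both of the following senses. (a) There are $\hat{\boldsymbol\lambda}\in\Lambda$ and a follower equilibrium $\hat{\boldsymbol\pi}$ at $\hat{\boldsymbol\lambda}$ with $u_0(\hat{\boldsymbol\lambda},\hat{\boldsymbol\pi})\ge u_0(\boldsymbol\lambda,\hat{\boldsymbol\pi})$ for all $\boldsymbol\lambda\in\Lambda$. (b) There are $\hat{\boldsymbol\lambda}\in\Lambda$ and a follower equilibrium $\hat{\boldsymbol\pi}$ at $\hat{\boldsymbol\lambda}$ with $u_0(\hat{\boldsymbol\lambda},\hat{\boldsymbol\pi})\ge u_0(\boldsymbol\lambda,\boldsymbol\pi)$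 for all $\boldsymbol\lambda\in\Lambda$ and all follower equilibria $\boldsymbol\pi$ at $\boldsymbol\lambda$. The pairs in (a) and (b) need not coincide. -/

import Mathlib

open scoped BigOperators

/-- A two-tier network with one macrocell link (index `0`) and `K` femtocell links
(index `k.succ` for the femtocell user `k : Fin K`). -/
structure FemtocellNetwork (K : ℕ) where
  /-- `h i j`: channel power gain from the transmitter of pair `i` to the receiver of pair `j`. -/
  h : Fin (K + 1) → Fin (K + 1) → ℝ
  /-- Noise variance at the receiver of each pair. -/
  N : Fin (K + 1) → ℝ
  /-- Fixed transmit power of the macrocell user. -/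
  p₀ : ℝ
  /-- Bandwidth. -/
  W : ℝ
  /-- Additional circuit power of a femtocell user. -/
  pa : ℝ
  h_nonneg : ∀ i j, 0 ≤ h i j
  h_macro_pos : ∀ k : Fin K, 0 < h k.succ 0
  N_pos : ∀ i, 0 < N i
  p₀_nonneg : 0 ≤ p₀
  W_pos : 0 < W
  pa_pos : 0 < pa

namespace FemtocellNetwork

noncomputable section

variable {K : ℕ}

/-- SINR at the access point of user `k` under the power vector `p`. -/
def sinr (net : FemtocellNetwork K) (k : Fin K) (p : Fin K → ℝ) : ℝ :=
  net.h k.succ k.succ * p k /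
    (net.N k.succ + net.h 0 k.succ * net.p₀
      + ∑ j ∈ Finset.univ.erase k, net.h j.succ k.succ * p j)

/-- Energy efficiency `ψ_k` of user `k` under the power vector `p`. -/
def efficiency (net : FemtocellNetwork K) (k : Fin K) (p : Fin K → ℝ) : ℝ :=
  net.W * Real.log (1 + net.sinr k p) / (p k + net.pa)

/-- A profile `q` of probability vectors, `q k` being one on the finite power set `P k`. -/
def IsMixedProfile (P : Fin K → Finset ℝ) (q : ∀ k : Fin K, P k → ℝ) : Prop :=
  ∀ k, q k ∈ stdSimplex ℝ (P k)

/-- The set of admissible price vectors: all (real, hence finite) nonnegative prices,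
with no upper bound. -/
def Prices (K : ℕ) : Set (Fin K → ℝ) := {lam | ∀ k, 0 ≤ lam k}

/-- Expected net payoff of user `k`: the sum over all pure power profiles `s` of the net payoff
at `s`, weighted by the probability of `s` when the users randomize independently. -/
def userPayoff (net : FemtocellNetwork K) (P : Fin K → Finset ℝ) (k : Fin K)
    (lam : Fin K → ℝ) (q : ∀ k : Fin K, P k → ℝ) : ℝ :=
  ∑ s : (∀ i : Fin K, P i),
    (net.efficiency k (fun i => (s i : ℝ)) - lam k * net.h k.succ 0 * (s k : ℝ))
      * ∏ i, q i (s i)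

/-- Expected revenue of the macrocell base station. -/
def revenue (net : FemtocellNetwork K) (P : Fin K → Finset ℝ)
    (lam : Fin K → ℝ) (q : ∀ k : Fin K, P k → ℝ) : ℝ :=
  ∑ k, lam k * ∑ a : P k, q k a * net.h k.succ 0 * (a : ℝ)

/-- `q` is a mixed-strategy Nash equilibrium of the follower game at the prices `lam`. -/
def IsFollowerNash (net : FemtocellNetwork K) (P : Fin K → Finset ℝ)
    (lam : Fin K → ℝ) (q : ∀ k : Fin K, P k → ℝ) : Prop :=
  IsMixedProfile P q ∧
    ∀ k, ∀ r ∈ stdSimplex ℝ (P k),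
      net.userPayoff P k lam (Function.update q k r) ≤ net.userPayoff P k lam q

/-- Stackelberg equilibrium as a pair from which neither the leader (the other side's strategies
being given) nor any follower has an incentive to deviate. -/
def IsStackelbergEq (net : FemtocellNetwork K) (P : Fin K → Finset ℝ)
    (lam : Fin K → ℝ) (q : ∀ k : Fin K, P k → ℝ) : Prop :=
  lam ∈ Prices K ∧
    (∀ lam' ∈ Prices K, net.revenue P lam' q ≤ net.revenue P lam q) ∧
    net.IsFollowerNash P lam q

/-- Stackelberg equilibrium with an anticipating leader: the followers are in Nash equilibrium, and
no admissible price vector together with a follower equilibrium for it has higher revenue. -/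
def IsAnticipatingStackelbergEq (net : FemtocellNetwork K) (P : Fin K → Finset ℝ)
    (lam : Fin K → ℝ) (q : ∀ k : Fin K, P k → ℝ) : Prop :=
  lam ∈ Prices K ∧
    net.IsFollowerNash P lam q ∧
    ∀ lam' ∈ Prices K, ∀ q', net.IsFollowerNash P lam' q' →
      net.revenue P lam' q' ≤ net.revenue P lam q

end

end FemtocellNetwork

/-!
Transmitting at zero power gives a user payoff zero, whatever the price. Since the power sets are
finite, there is for each user a price `priceCap` above which every positive power has negative
payoff, so that above it zero power is the strictly dominant strategy
(`IsFollowerNash.eq_zero_of_priceCap_le`). Two consequences prove the theorem.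

* At the cap prices the profile in which nobody transmits is a follower equilibrium
  (`isFollowerNash_priceCap`). The revenue from this profile vanishes at all prices, so the leader
  cannot gain by deviating. This is the only way in which a leader with unbounded prices and fixed
  followers can be in equilibrium: a positive expected power would make the revenue unbounded.
* For an anticipating leader, truncating the prices at the cap preserves both the follower
  equilibrium and the revenue (`IsFollowerNash.inf_priceCap`, `IsFollowerNash.revenue_inf_priceCap`),
  because a user whose price is truncated does not transmit. Hence it suffices to maximize the
  revenue, a continuous function, over the pairs of a price vector in the box `[0, priceCap]` and a
  follower equilibrium for it. These pairs form a compact set (`isCompact_cappedNash`), nonempty by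
  the first point. No fixed point theorem is needed.
-/

namespace FemtocellNetwork

variable {K : ℕ} {net : FemtocellNetwork K} {P : Fin K → Finset ℝ} {k : Fin K}
  {lam lam' : Fin K → ℝ} {q : ∀ k : Fin K, P k → ℝ}

lemma efficiency_eq_zero {p : Fin K → ℝ} (hp : p k = 0) : net.efficiency k p = 0 := by
  simp [efficiency, sinr, hp]

/-- A price for user `k` at which every positive power in `P k` has negative net payoff, whatever
the other users do. Profiles `s` with `s k = 0` contribute `0` to the sum, by the convention
`x / 0 = 0`. -/
noncomputable def priceCap (net : FemtocellNetwork K) (P : Fin K → Finset ℝ) (k : Fin K) : ℝ :=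
  1 + ∑ s : (∀ i, P i), |net.efficiency k (fun i => (s i : ℝ)) / (net.h k.succ 0 * (s k : ℝ))|

lemma priceCap_nonneg : 0 ≤ net.priceCap P k :=
  add_nonneg zero_le_one (Finset.sum_nonneg fun _ _ => abs_nonneg _)

lemma efficiency_sub_neg (hlam : net.priceCap P k ≤ lam k) (s : ∀ i, P i)
    (hs : 0 < (s k : ℝ)) :
    net.efficiency k (fun i => (s i : ℝ)) - lam k * net.h k.succ 0 * (s k : ℝ) < 0 := by
  have hpos : 0 < net.h k.succ 0 * (s k : ℝ) := mul_pos (net.h_macro_pos k) hs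
  have h₁ := Finset.single_le_sum (f := fun s : (∀ i, P i) =>
    |net.efficiency k (fun i => (s i : ℝ)) / (net.h k.succ 0 * (s k : ℝ))|)
    (fun _ _ => abs_nonneg _) (Finset.mem_univ s)
  have h₂ : net.efficiency k (fun i => (s i : ℝ)) / (net.h k.succ 0 * (s k : ℝ)) < lam k := by
    have h₃ := le_abs_self
      (net.efficiency k (fun i => (s i : ℝ)) / (net.h k.succ 0 * (s k : ℝ)))
    unfold priceCap at hlam
    linarith
  rw [div_lt_iff₀ hpos] at h₂
  linarith

lemma efficiency_sub_nonpos (hnonneg : ∀ k, ∀ p ∈ P k, 0 ≤ p)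
    (hlam : net.priceCap P k ≤ lam k) (s : ∀ i, P i) :
    net.efficiency k (fun i => (s i : ℝ)) - lam k * net.h k.succ 0 * (s k : ℝ) ≤ 0 := by
  rcases (hnonneg k _ (s k).2).eq_or_lt with h | h
  · simp [efficiency_eq_zero (net := net) (p := fun i => (s i : ℝ)) h.symm, ← h]
  · exact (efficiency_sub_neg hlam s h).le

lemma userPayoff_nonpos (hnonneg : ∀ k, ∀ p ∈ P k, 0 ≤ p)
    (hlam : net.priceCap P k ≤ lam k) (hq : IsMixedProfile P q) :
    net.userPayoff P k lam q ≤ 0 :=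
  Finset.sum_nonpos fun s _ => mul_nonpos_of_nonpos_of_nonneg
    (efficiency_sub_nonpos hnonneg hlam s) (Finset.prod_nonneg fun i _ => (hq i).1 _)

lemma userPayoff_eq_zero (hq : ∀ a : P k, (a : ℝ) ≠ 0 → q k a = 0) :
    net.userPayoff P k lam q = 0 := by
  refine Finset.sum_eq_zero fun s _ => ?_
  by_cases hs : (s k : ℝ) = 0
  · simp [efficiency_eq_zero (net := net) (p := fun i => (s i : ℝ)) hs, hs]
  · rw [Finset.prod_eq_zero (Finset.mem_univ k) (hq _ hs), mul_zero]

lemma userPayoff_congr (h : lam k = lam' k) :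
    net.userPayoff P k lam q = net.userPayoff P k lam' q := by
  simp only [userPayoff, h]

lemma IsMixedProfile.update (hq : IsMixedProfile P q) {r : P k → ℝ}
    (hr : r ∈ stdSimplex ℝ (P k)) : IsMixedProfile P (Function.update q k r) := by
  intro i
  rcases eq_or_ne i k with rfl | h
  · simpa using hr
  · simpa [h] using hq i

lemma IsMixedProfile.exists_pos (hq : IsMixedProfile P q) (i : Fin K) : ∃ a, 0 < q i a := by
  by_contra! h
  have := Finset.sum_nonpos fun a (_ : a ∈ Finset.univ) => h a
  linarith [(hq i).2]

/-- The pure strategy of not transmitting. -/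
noncomputable def silent (P : Fin K → Finset ℝ) (hzero : ∀ k, (0 : ℝ) ∈ P k) (k : Fin K) :
    P k → ℝ :=
  Pi.single ⟨0, hzero k⟩ 1

lemma silent_mem_stdSimplex (hzero : ∀ k, (0 : ℝ) ∈ P k) :
    silent P hzero k ∈ stdSimplex ℝ (P k) :=
  single_mem_stdSimplex ℝ _

lemma silent_eq_zero (hzero : ∀ k, (0 : ℝ) ∈ P k) (a : P k) (ha : (a : ℝ) ≠ 0) :
    silent P hzero k a = 0 :=
  Pi.single_eq_of_ne (fun h => ha (by rw [h])) _

/-- Above the cap, zero power is played with probability one: its payoff is zero, while any positive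
power played with positive probability would make the expected payoff negative. -/
lemma IsFollowerNash.eq_zero_of_priceCap_le (hzero : ∀ k, (0 : ℝ) ∈ P k)
    (hnonneg : ∀ k, ∀ p ∈ P k, 0 ≤ p) (hq : net.IsFollowerNash P lam q)
    (hlam : net.priceCap P k ≤ lam k) (a : P k) (ha : (a : ℝ) ≠ 0) : q k a = 0 := by
  by_contra hne
  have hdev := hq.2 k _ (silent_mem_stdSimplex hzero)
  rw [userPayoff_eq_zero (by simpa using fun x hx => silent_eq_zero hzero (k := k) ⟨x, hx⟩)]
    at hdev
  -- A pure profile of positive probability in which user `k` plays `a`.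
  choose b hb using hq.1.exists_pos
  set s := Function.update b k a with hs
  have hsk : s k = a := by simp [hs]
  have hpos : 0 < ∏ i, q i (s i) := by
    refine Finset.prod_pos fun i _ => ?_
    rcases eq_or_ne i k with rfl | h
    · rw [hsk]
      exact lt_of_le_of_ne ((hq.1 i).1 a) (Ne.symm hne)
    · simpa [hs, h] using hb i
  have hneg : net.userPayoff P k lam q < 0 := by
    refine Finset.sum_neg' (fun t _ => mul_nonpos_of_nonpos_of_nonneg
      (efficiency_sub_nonpos hnonneg hlam t) (Finset.prod_nonneg fun i _ => (hq.1 i).1 _))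
      ⟨s, Finset.mem_univ s, mul_neg_of_neg_of_pos (efficiency_sub_neg hlam s ?_) hpos⟩
    rw [hsk]
    exact lt_of_le_of_ne (hnonneg k _ a.2) (Ne.symm ha)
  linarith

lemma isFollowerNash_priceCap (hzero : ∀ k, (0 : ℝ) ∈ P k)
    (hnonneg : ∀ k, ∀ p ∈ P k, 0 ≤ p) :
    net.IsFollowerNash P (net.priceCap P) (silent P hzero) := by
  have hmix : IsMixedProfile P (silent P hzero) := fun k => silent_mem_stdSimplex hzero
  refine ⟨hmix, fun k r hr => ?_⟩
  rw [userPayoff_eq_zero (silent_eq_zero hzero)]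
  exact userPayoff_nonpos hnonneg le_rfl (hmix.update hr)

/-- Truncating the prices at the caps preserves a follower equilibrium: a user whose price drops
does not transmit, and at the cap this is still a best response. -/
lemma IsFollowerNash.inf_priceCap (hzero : ∀ k, (0 : ℝ) ∈ P k)
    (hnonneg : ∀ k, ∀ p ∈ P k, 0 ≤ p) (hq : net.IsFollowerNash P lam q) :
    net.IsFollowerNash P (lam ⊓ net.priceCap P) q := by
  refine ⟨hq.1, fun k r hr => ?_⟩
  rcases le_total (lam k) (net.priceCap P k) with h | h
  · have he : (lam ⊓ net.priceCap P) k = lam k := inf_eq_left.2 h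
    rw [userPayoff_congr he, userPayoff_congr he]
    exact hq.2 k r hr
  · rw [userPayoff_eq_zero (hq.eq_zero_of_priceCap_le hzero hnonneg h)]
    exact userPayoff_nonpos hnonneg (inf_eq_right.2 h).ge (hq.1.update hr)

lemma sum_mul_eq_zero {r : P k → ℝ} (hr : ∀ a : P k, (a : ℝ) ≠ 0 → r a = 0) :
    ∑ a : P k, r a * net.h k.succ 0 * (a : ℝ) = 0 := by
  refine Finset.sum_eq_zero fun a _ => ?_
  by_cases ha : (a : ℝ) = 0
  · rw [ha, mul_zero]
  · rw [hr a ha, zero_mul, zero_mul]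

lemma IsFollowerNash.revenue_inf_priceCap (hzero : ∀ k, (0 : ℝ) ∈ P k)
    (hnonneg : ∀ k, ∀ p ∈ P k, 0 ≤ p) (hq : net.IsFollowerNash P lam q) :
    net.revenue P (lam ⊓ net.priceCap P) q = net.revenue P lam q := by
  refine Finset.sum_congr rfl fun k _ => ?_
  rcases le_total (lam k) (net.priceCap P k) with h | h
  · rw [Pi.inf_apply, inf_eq_left.2 h]
  · rw [sum_mul_eq_zero (hq.eq_zero_of_priceCap_le hzero hnonneg h), mul_zero, mul_zero]

lemma continuous_userPayoff :
    Continuous fun x : (Fin K → ℝ) × (∀ k : Fin K, P k → ℝ) => net.userPayoff P k x.1 x.2 := by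
  unfold userPayoff
  fun_prop

lemma continuous_revenue :
    Continuous fun x : (Fin K → ℝ) × (∀ k : Fin K, P k → ℝ) => net.revenue P x.1 x.2 := by
  unfold revenue
  fun_prop

lemma isCompact_cappedNash :
    IsCompact {x : (Fin K → ℝ) × (∀ k : Fin K, P k → ℝ) |
      x.1 ∈ Set.Icc 0 (net.priceCap P) ∧ net.IsFollowerNash P x.1 x.2} := by
  have hbox : IsCompact (Set.Icc 0 (net.priceCap P) ×ˢ
      Set.univ.pi fun k : Fin K => stdSimplex ℝ (P k)) :=
    isCompact_Icc.prod (isCompact_univ_pi fun k => isCompact_stdSimplex ℝ (P k))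
  have hclosed : IsClosed {x : (Fin K → ℝ) × (∀ k : Fin K, P k → ℝ) |
      ∀ k, ∀ r ∈ stdSimplex ℝ (P k),
        net.userPayoff P k x.1 (Function.update x.2 k r) ≤ net.userPayoff P k x.1 x.2} := by
    simp only [Set.ofPred_forall]
    refine isClosed_iInter fun k => isClosed_iInter fun r => isClosed_iInter fun _ =>
      isClosed_le ?_ continuous_userPayoff
    exact continuous_userPayoff.comp
      (continuous_fst.prodMk (continuous_snd.update k continuous_const))
  convert hbox.inter_right hclosed using 1
  ext x
  simp only [IsFollowerNash, IsMixedProfile, Set.mem_ofPred_eq, Set.mem_inter_iff, Set.mem_prod,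
    Set.mem_univ_pi, and_assoc]

end FemtocellNetwork

open FemtocellNetwork in
theorem theorem5 {K : ℕ} (net : FemtocellNetwork K) (P : Fin K → Finset ℝ)
    (hzero : ∀ k, (0 : ℝ) ∈ P k) (hnonneg : ∀ k, ∀ p ∈ P k, 0 ≤ p) :
    (∃ (lam : Fin K → ℝ) (q : ∀ k : Fin K, P k → ℝ), net.IsStackelbergEq P lam q) ∧
    (∃ (lam : Fin K → ℝ) (q : ∀ k : Fin K, P k → ℝ),
      net.IsAnticipatingStackelbergEq P lam q) := by
  have hNash := isFollowerNash_priceCap (net := net) hzero hnonneg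
  constructor
  · refine ⟨net.priceCap P, silent P hzero, fun k => priceCap_nonneg, fun lam' _ => ?_, hNash⟩
    simp only [revenue, sum_mul_eq_zero (silent_eq_zero hzero), mul_zero, le_refl]
  · obtain ⟨⟨lam, q⟩, ⟨hlam, hq⟩, hmax⟩ := (isCompact_cappedNash (net := net) (P := P)).exists_isMaxOn
      ⟨(net.priceCap P, silent P hzero), ⟨fun _ => priceCap_nonneg, le_rfl⟩, hNash⟩
      continuous_revenue.continuousOn
    refine ⟨lam, q, hlam.1, hq, fun lam' hlam' q' hq' => ?_⟩
    rw [← hq'.revenue_inf_priceCap hzero hnonneg]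
    exact hmax (a := (lam' ⊓ net.priceCap P, q'))
      ⟨⟨le_inf hlam' fun _ => priceCap_nonneg, inf_le_right⟩, hq'.inf_priceCap hzero hnonneg⟩
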